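/- Let $\mu$ be a positive Borel measure on $\mathbb R$ with (real-valued) distribution function $N$, i.e. $N(E)=\mu(]-\infty,E[)$ for all $E\in\mathbb R$, or $N(E)=\mu(]-\infty,E])$ for all $E\in\mathbb R$ (either normalization is allowed). Assume that there is $\eta\in\mathbb R$ with $N(E)=0$ for all $E\le\eta$, put $$\widetilde N(t):=e^{t\eta}\int_{[\eta,\infty[}e^{-tx}\,\mu(dx)=\int_{[0,\infty[}e^{-tE}\,dN(\eta+E)\in[0,\infty],\qquad t>0,$$ and suppose that $\widetilde N(\tau)<\infty$ for some $\tau>0$. A function $f$ on $]0,\infty[$ is called slowly varying if it is positive and measurable and $f(ct)/f(t)\to1$ as $t\to\infty$ for every $c>0$. Let $(f,f^{\#})$ be a de Bruijn conjugate pair, i.e. $f$ and $f^{\#}$ are slowly varying and $$f(t)\,f^{\#}(t f(t))\to1\quad\text{and}\quad f^{\#}(t)\,f(t f^{\#}(t))\to1\qquad(t\to\infty).$$ Let $\gamma\in[0,1[$. Then $$\log\widetilde N(t)\;\sim\;-t^{\gamma}\,[f(t)]^{\gamma-1}\qquad(t\to\infty)$$ if and only if $$\log N(\eta+E)\;\sim\;-(1-\gamma)\Big(\frac{\gamma}{E}\Big)^{\gamma/(1-\gamma)}f^{\#}\big(E^{1/(\gamma-1)}\big)\qquad(E\downarrow0),$$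 where $F\sim G$ means $F/G\to1$, and for $\gamma=0$ the factor $(\gamma/E)^{\gamma/(1-\gamma)}$ is $0^0=1$. -/

import Mathlib

open Filter Topology MeasureTheory Set

/-- `F ~ G` along the filter `l`: the quotient `F / G` tends to `1`. -/
def AsympEquiv (l : Filter ℝ) (F G : ℝ → ℝ) : Prop :=
  Tendsto (fun x => F x / G x) l (𝓝 1)

/-- `f` is slowly varying at infinity: positive and measurable on the positive half-line, with
`f (c t) / f t → 1` as `t → ∞` for every `c > 0`. Values outside `]0, ∞[` are irrelevant. -/
structure SlowlyVarying (f : ℝ → ℝ) : Prop where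
  pos : ∀ t, 0 < t → 0 < f t
  meas : Measurable ((Ioi (0 : ℝ)).domRestrict f)
  tendsto : ∀ c, 0 < c → Tendsto (fun t => f (c * t) / f t) atTop (𝓝 1)

/-- `(f, g)` is a conjugate pair: `g` is a de Bruijn conjugate `f^#` of `f`. -/
structure DeBruijnConjugatePair (f g : ℝ → ℝ) : Prop where
  slow_left : SlowlyVarying f
  slow_right : SlowlyVarying g
  tendsto_left : Tendsto (fun t => f t * g (t * f t)) atTop (𝓝 1)
  tendsto_right : Tendsto (fun t => g t * f (t * g t)) atTop (𝓝 1)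

/-- `N` is the (real-valued) distribution function of the positive Borel measure `μ` on `ℝ`.
Both usual normalizations are admitted: the left-continuous one `N E = μ ]-∞, E[` and the
right-continuous one `N E = μ ]-∞, E]`. -/
def IsDistributionFunction (N : ℝ → ℝ) (μ : Measure ℝ) : Prop :=
  (∀ E, 0 ≤ N E) ∧
    ((∀ E, μ (Iio E) = ENNReal.ofReal (N E)) ∨ (∀ E, μ (Iic E) = ENNReal.ofReal (N E)))

/-- The shifted Laplace–Stieltjes transform `e^{t η} ∫_{[η, ∞[} e^{-t x} dμ(x)`, as an element of
`[0, ∞]`. The lower end point is included, so that an atom at `η` counts. -/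
noncomputable def shiftedLaplace (μ : Measure ℝ) (η t : ℝ) : ENNReal :=
  ENNReal.ofReal (Real.exp (t * η)) *
    ∫⁻ x in Ici η, ENNReal.ofReal (Real.exp (-(t * x))) ∂μ

/-- The other form of the transform: the integral of `e^{-t E}` over `E ≥ 0` against the
translate of `μ` by `-η`, whose distribution function is `E ↦ N (η + E)`. -/
theorem shiftedLaplace_eq (μ : Measure ℝ) (η t : ℝ) :
    shiftedLaplace μ η t =
      ∫⁻ E in Ici 0, ENNReal.ofReal (Real.exp (-(t * E))) ∂(μ.map (fun x => x - η)) := by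
  rw [setLIntegral_map measurableSet_Ici (by fun_prop) (by fun_prop), shiftedLaplace,
    ← lintegral_const_mul _ (by fun_prop)]
  have h : (fun x : ℝ => x - η) ⁻¹' Ici 0 = Ici η := by ext x; simp
  rw [h]
  refine lintegral_congr fun x => ?_
  rw [← ENNReal.ofReal_mul (Real.exp_pos _).le, ← Real.exp_add]
  congr 2
  ring

/-!
Write `F` for the Laplace transform of the shifted measure, `n` for its distribution function and
`g` for the conjugate of `f`. On an exponential scale `F` and `n` are Legendre dual:
`-log F(t) ≈ inf_E (t E - log n(E))` and `-log n(E) ≈ sup_t (-log F(t) - t E)`. One inequality in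
each is Chernoff's bound `e^{-tE} n(E) ≤ F(t)`. The other inequalities come from splitting the
Laplace integral. For the Abelian direction the half-line is cut into finitely many pieces of
length `ε E` and a tail, so that `F` is a sum of boundedly many terms, each of a known exponential rate
(`IsLaplacePair.abelian`). For the Tauberian direction the integral at `t` is concentrated near its
saddle point: tilting to a slightly smaller (larger) argument shows that the contribution far to
the right (left) has a strictly larger rate, by strict concavity of `x ^ γ - x`
(`IsLaplacePair.tauberian`). Both arguments only use the rates at fixed multiples of one pair
`(t, E)`, at speed `Φ = t E → ∞`.

The conjugate pair supplies matching scales. Given `t`, put `u = t f(t)` and `E = u ^ (γ - 1)`;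
given `E`, put `u = E ^ (1 / (γ - 1))` and `t = u g(u)`. In both cases `f(t) g(u) → 1`, and slow
variation along fixed multiples turns the two asserted equivalences into the hypotheses of the
preceding results. That `u`, `t` and, for `γ > 0`, the speed tend to infinity follows from the
uniform convergence theorem (`uniform_of_tendsto_sub`), which is where measurability enters.

For `γ = 0` the speed may stay bounded. It tends to infinity if the origin has no mass; if it has
mass `c > 0`, then `F` and `n` both decrease to `c`, and both equivalences mean that
`f → -1 / log c > 0`, or equivalently `g → -log c > 0`.
-/

/-! ### Exponential inequalities for Laplace transforms -/

/-- `F` is (a real version of) the Laplace transform on `[τ, ∞[` of a measure `ρ` carried by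
`[0, ∞[`, and `n` is a distribution function of `ρ`. The two inequalities `iio_le` and `le_iic`
hold for the left- and for the right-continuous normalization alike. -/
structure IsLaplacePair (ρ : Measure ℝ) (F n : ℝ → ℝ) (τ : ℝ) : Prop where
  pos_abscissa : 0 < τ
  transform_nonneg : ∀ t, 0 ≤ F t
  distrib_nonneg : ∀ E, 0 ≤ n E
  null : ρ (Iio 0) = 0
  transform : ∀ t, τ ≤ t → ∫⁻ x, ENNReal.ofReal (Real.exp (-(t * x))) ∂ρ = ENNReal.ofReal (F t)
  iio_le : ∀ E, ρ (Iio E) ≤ ENNReal.ofReal (n E)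
  le_iic : ∀ E, ENNReal.ofReal (n E) ≤ ρ (Iic E)

/-- Exponential tilting: on a set where `e^{-tx} ≤ c e^{-sx}`, the Laplace integral at `t` is
controlled by the one at `s`. -/
theorem setLIntegral_exp_le (ρ : Measure ℝ) {A : Set ℝ} (hA : MeasurableSet A) {c t s : ℝ}
    (hc : 0 ≤ c) (h : ∀ x ∈ A, Real.exp (-(t * x)) ≤ c * Real.exp (-(s * x))) :
    ∫⁻ x in A, ENNReal.ofReal (Real.exp (-(t * x))) ∂ρ ≤
      ENNReal.ofReal c * ∫⁻ x in A, ENNReal.ofReal (Real.exp (-(s * x))) ∂ρ := by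
  rw [← lintegral_const_mul _ (by fun_prop)]
  refine setLIntegral_mono' hA fun x hx => ?_
  rw [← ENNReal.ofReal_mul hc]
  exact ENNReal.ofReal_le_ofReal (h x hx)

namespace IsLaplacePair

variable {ρ : Measure ℝ} {F n : ℝ → ℝ} {τ : ℝ}

/-- Chernoff's inequality. -/
theorem exp_mul_le (h : IsLaplacePair ρ F n τ) {t : ℝ} (ht : τ ≤ t) (E : ℝ) :
    Real.exp (-(t * E)) * n E ≤ F t := by
  have ht0 : 0 ≤ t := h.pos_abscissa.le.trans ht
  rw [← ENNReal.ofReal_le_ofReal_iff (h.transform_nonneg t), ← h.transform t ht,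
    ENNReal.ofReal_mul (Real.exp_pos _).le]
  calc _ ≤ ENNReal.ofReal (Real.exp (-(t * E))) * ρ (Iic E) := by gcongr; exact h.le_iic E
    _ = ∫⁻ x in Iic E, ENNReal.ofReal (Real.exp (-(t * E))) ∂ρ := by
        rw [setLIntegral_const]
    _ ≤ ∫⁻ x in Iic E, ENNReal.ofReal (Real.exp (-(t * x))) ∂ρ := by
        refine setLIntegral_mono' measurableSet_Iic fun x hx => ?_
        have : t * x ≤ t * E := mul_le_mul_of_nonneg_left hx ht0
        gcongr
    _ ≤ _ := setLIntegral_le_lintegral _ _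

theorem setLIntegral_Ici_le (h : IsLaplacePair ρ F n τ) {s t : ℝ} (hs : τ ≤ s) (hst : s ≤ t)
    (b : ℝ) :
    ∫⁻ x in Ici b, ENNReal.ofReal (Real.exp (-(t * x))) ∂ρ ≤
      ENNReal.ofReal (Real.exp (-((t - s) * b)) * F s) := by
  rw [ENNReal.ofReal_mul (Real.exp_pos _).le, ← h.transform s hs]
  refine (setLIntegral_exp_le ρ measurableSet_Ici (Real.exp_pos _).le fun x hx => ?_).trans
    (mul_le_mul_right (setLIntegral_le_lintegral _ _) _)
  rw [← Real.exp_add, Real.exp_le_exp]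
  nlinarith [mul_nonneg (sub_nonneg.2 hst) (sub_nonneg.2 (mem_Ici.1 hx))]

theorem setLIntegral_Iio_le (h : IsLaplacePair ρ F n τ) {s t : ℝ} (hs : τ ≤ s) (hst : t ≤ s)
    (a : ℝ) :
    ∫⁻ x in Iio a, ENNReal.ofReal (Real.exp (-(t * x))) ∂ρ ≤
      ENNReal.ofReal (Real.exp ((s - t) * a) * F s) := by
  rw [ENNReal.ofReal_mul (Real.exp_pos _).le, ← h.transform s hs]
  refine (setLIntegral_exp_le ρ measurableSet_Iio (Real.exp_pos _).le fun x hx => ?_).trans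
    (mul_le_mul_right (setLIntegral_le_lintegral _ _) _)
  rw [← Real.exp_add, Real.exp_le_exp]
  nlinarith [mul_nonneg (sub_nonneg.2 hst) (sub_nonneg.2 (mem_Iio.1 hx).le)]

theorem setLIntegral_Ico_le (h : IsLaplacePair ρ F n τ) {t : ℝ} (ht : 0 ≤ t) (a b : ℝ) :
    ∫⁻ x in Ico a b, ENNReal.ofReal (Real.exp (-(t * x))) ∂ρ ≤
      ENNReal.ofReal (Real.exp (-(t * a)) * n b) := by
  rw [ENNReal.ofReal_mul (Real.exp_pos _).le]
  calc _ ≤ ∫⁻ x in Ico a b, ENNReal.ofReal (Real.exp (-(t * a))) ∂ρ := by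
        refine setLIntegral_mono' measurableSet_Ico fun x hx => ?_
        have : t * a ≤ t * x := mul_le_mul_of_nonneg_left hx.1 ht
        gcongr
    _ = ENNReal.ofReal (Real.exp (-(t * a))) * ρ (Ico a b) := by rw [setLIntegral_const]
    _ ≤ _ := by
        gcongr
        exact (measure_mono Ico_subset_Iio_self).trans (h.iio_le b)

/-- Bound for the Laplace transform obtained by splitting `[0, ∞[` at `d, 2d, …, kd`. -/
theorem le_sum (h : IsLaplacePair ρ F n τ) {t d : ℝ} (ht : τ ≤ t) (hd : 0 ≤ d) (k : ℕ) :
    F t ≤ ∑ i ∈ Finset.range k, Real.exp (-(t * (i * d))) * n ((i + 1) * d) +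
      Real.exp (-((t - τ) * (k * d))) * F τ := by
  have ht0 : 0 ≤ t := h.pos_abscissa.le.trans ht
  have key : ∀ k : ℕ, ∫⁻ x in Iio (k * d), ENNReal.ofReal (Real.exp (-(t * x))) ∂ρ ≤
      ENNReal.ofReal (∑ i ∈ Finset.range k, Real.exp (-(t * (i * d))) * n ((i + 1) * d)) := by
    intro k
    induction k with
    | zero => simp [Measure.restrict_eq_zero.2 h.null]
    | succ k ih =>
      have hsub : Iio (((k + 1 : ℕ) : ℝ) * d) = Iio (k * d) ∪ Ico (k * d) ((k + 1) * d) := by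
        rw [Iio_union_Ico_eq_Iio (by nlinarith)]; push_cast; rfl
      rw [hsub, Finset.sum_range_succ, ENNReal.ofReal_add
        (Finset.sum_nonneg fun i _ => mul_nonneg (Real.exp_pos _).le (h.distrib_nonneg _))
        (mul_nonneg (Real.exp_pos _).le (h.distrib_nonneg _))]
      exact (lintegral_union_le _ _ _).trans (add_le_add ih (h.setLIntegral_Ico_le ht0 _ _))
  have hs : 0 ≤ ∑ i ∈ Finset.range k, Real.exp (-(t * (i * d))) * n ((i + 1) * d) :=
    Finset.sum_nonneg fun i _ => mul_nonneg (Real.exp_pos _).le (h.distrib_nonneg _)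
  have ht' : 0 ≤ Real.exp (-((t - τ) * (k * d))) * F τ :=
    mul_nonneg (Real.exp_pos _).le (h.transform_nonneg _)
  rw [← ENNReal.ofReal_le_ofReal_iff (add_nonneg hs ht'), ← h.transform t ht,
    ENNReal.ofReal_add hs ht', ← setLIntegral_univ, ← Iio_union_Ici (a := (k : ℝ) * d)]
  exact (lintegral_union_le _ _ _).trans (add_le_add (key k) (h.setLIntegral_Ici_le le_rfl ht _))

/-- Bound for the Laplace transform at `t` obtained by splitting `[0, ∞[` at `a` and `b`, and
tilting to `s₂ ≥ t` below `a` and to `s₁ ≤ t` above `b`. -/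
theorem le_three (h : IsLaplacePair ρ F n τ) {t s₁ s₂ a b : ℝ} (hs₁ : τ ≤ s₁) (h₁ : s₁ ≤ t)
    (h₂ : t ≤ s₂) (hab : a ≤ b) :
    F t ≤ Real.exp ((s₂ - t) * a) * F s₂ + Real.exp (-(t * a)) * n b +
      Real.exp (-((t - s₁) * b)) * F s₁ := by
  have e₁ : 0 ≤ Real.exp ((s₂ - t) * a) * F s₂ := mul_nonneg (Real.exp_pos _).le
    (h.transform_nonneg _)
  have e₂ : 0 ≤ Real.exp (-(t * a)) * n b := mul_nonneg (Real.exp_pos _).le (h.distrib_nonneg _)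
  have e₃ : 0 ≤ Real.exp (-((t - s₁) * b)) * F s₁ := mul_nonneg (Real.exp_pos _).le
    (h.transform_nonneg _)
  rw [← ENNReal.ofReal_le_ofReal_iff (by positivity), ← h.transform t (hs₁.trans h₁),
    ENNReal.ofReal_add (by positivity) e₃, ENNReal.ofReal_add e₁ e₂, ← setLIntegral_univ,
    ← Iio_union_Ici (a := b), ← Iio_union_Ico_eq_Iio hab]
  refine (lintegral_union_le _ _ _).trans (add_le_add ((lintegral_union_le _ _ _).trans
    (add_le_add ?_ ?_)) ?_)
  · exact h.setLIntegral_Iio_le (hs₁.trans (h₁.trans h₂)) h₂ a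
  · exact h.setLIntegral_Ico_le ((h.pos_abscissa.le.trans hs₁).trans h₁) a b
  · exact h.setLIntegral_Ici_le hs₁ h₁ b

/-- Bound for the Laplace transform at `t` obtained by splitting `[0, ∞[` at `b` and tilting to
`s ≤ t` above `b`. -/
theorem le_two (h : IsLaplacePair ρ F n τ) {t s b : ℝ} (hs : τ ≤ s) (hst : s ≤ t) (hb : 0 ≤ b) :
    F t ≤ n b + Real.exp (-((t - s) * b)) * F s := by
  have e₃ : 0 ≤ Real.exp (-((t - s) * b)) * F s := mul_nonneg (Real.exp_pos _).le
    (h.transform_nonneg _)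
  have e₂ := h.distrib_nonneg b
  rw [← ENNReal.ofReal_le_ofReal_iff (by positivity), ← h.transform t (hs.trans hst),
    ENNReal.ofReal_add e₂ e₃, ← setLIntegral_univ,
    ← Iio_union_Ici (a := b), ← Iio_union_Ico_eq_Iio hb]
  refine (lintegral_union_le _ _ _).trans (add_le_add ((lintegral_union_le _ _ _).trans ?_)
    (h.setLIntegral_Ici_le hs hst b))
  have := h.setLIntegral_Ico_le ((h.pos_abscissa.le.trans hs).trans hst) 0 b
  simpa [Measure.restrict_eq_zero.2 h.null] using this

theorem antitone (h : IsLaplacePair ρ F n τ) {s t : ℝ} (hs : τ ≤ s) (hst : s ≤ t) :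
    F t ≤ F s := by
  have := h.setLIntegral_Ici_le hs hst 0
  rw [← ENNReal.ofReal_le_ofReal_iff (h.transform_nonneg s), ← h.transform t (hs.trans hst),
    ← setLIntegral_univ, ← Iio_union_Ici (a := (0 : ℝ))]
  refine (lintegral_union_le _ _ _).trans ?_
  simpa [Measure.restrict_eq_zero.2 h.null] using this

/-- The transform at infinity and the distribution function at `0` have the same limit, the
mass of the origin, and are bounded below by it. -/
theorem exists_limit (h : IsLaplacePair ρ F n τ) :
    ∃ c, 0 ≤ c ∧ (∀ t, τ ≤ t → c ≤ F t) ∧ (∀ E, 0 < E → c ≤ n E) ∧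
      Tendsto F atTop (𝓝 c) ∧ Tendsto n (𝓝[>] 0) (𝓝 c) := by
  have hbdd : BddBelow (range fun t => F (max t τ)) := ⟨0, by
    rintro _ ⟨t, rfl⟩; exact h.transform_nonneg _⟩
  have hanti : Antitone fun t => F (max t τ) := fun s t hst =>
    h.antitone (le_max_right _ _) (max_le_max_right _ hst)
  set c := ⨅ t, F (max t τ) with hc
  have hF : Tendsto F atTop (𝓝 c) := by
    refine (tendsto_atTop_ciInf hanti hbdd).congr' ?_
    filter_upwards [eventually_ge_atTop τ] with t ht
    rw [max_eq_left ht]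
  have hcF : ∀ t, τ ≤ t → c ≤ F t := fun t ht => by
    simpa [max_eq_left ht] using ciInf_le hbdd t
  have hcn : ∀ E, 0 < E → c ≤ n E := fun E hE => by
    have h1 : Tendsto (fun t => n E + Real.exp (-((t - τ) * E)) * F τ) atTop
        (𝓝 (n E + 0 * F τ)) := by
      refine tendsto_const_nhds.add (Tendsto.mul_const _ ?_)
      refine Real.tendsto_exp_neg_atTop_nhds_zero.comp ?_
      exact (tendsto_atTop_add_const_right _ (-τ) tendsto_id).atTop_mul_const hE
    have h2 := le_of_tendsto_of_tendsto hF h1 <| by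
      filter_upwards [eventually_ge_atTop τ] with t ht
      exact h.le_two le_rfl ht hE.le
    simpa using h2
  refine ⟨c, le_ciInf fun t => h.transform_nonneg _, hcF, hcn, hF, ?_⟩
  rw [tendsto_order]
  refine ⟨fun a ha => ?_, fun a ha => ?_⟩
  · filter_upwards [self_mem_nhdsWithin] with E hE
    exact ha.trans_le (hcn E hE)
  · obtain ⟨t, hta, ht⟩ := ((hF.eventually (gt_mem_nhds ha)).and (eventually_ge_atTop τ)).exists
    have h3 : Tendsto (fun E : ℝ => Real.exp (t * E) * F t) (𝓝[>] 0) (𝓝 (F t)) := by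
      have : Continuous fun E : ℝ => Real.exp (t * E) * F t := by fun_prop
      simpa using (this.tendsto 0).mono_left nhdsWithin_le_nhds
    filter_upwards [h3.eventually (gt_mem_nhds hta)] with E hE
    refine lt_of_le_of_lt ?_ hE
    have := mul_le_mul_of_nonneg_left (h.exp_mul_le ht E) (Real.exp_pos (t * E)).le
    rwa [← mul_assoc, ← Real.exp_add, add_neg_cancel, Real.exp_zero, one_mul] at this

end IsLaplacePair

/-! ### Growth of slowly varying functions -/

/-- Uniform convergence theorem in additive form: if `h` is measurable and
`h (x + u) - h x → 0` as `x → ∞` for each `u`, then the convergence is uniform in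
`u ∈ [0, 1]`. -/
theorem uniform_of_tendsto_sub {h : ℝ → ℝ} (hm : Measurable h)
    (ht : ∀ u, Tendsto (fun x => h (x + u) - h x) atTop (𝓝 0)) {δ : ℝ} (hδ : 0 < δ) :
    ∃ X, ∀ x, X ≤ x → ∀ u ∈ Icc (0 : ℝ) 1, |h (x + u) - h x| ≤ δ := by
  set g : ℝ → ℝ → ℝ := fun x u => min 1 |h (x + u) - h x| with hg
  have hg0 : ∀ x u, 0 ≤ g x u := fun x u => le_min zero_le_one (abs_nonneg _)
  have hg1 : ∀ x u, g x u ≤ 1 := fun x u => min_le_left _ _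
  have hgm : ∀ x, Measurable (g x) := fun x => by
    simp only [hg]; fun_prop
  have hgi : ∀ x a b, IntervalIntegrable (g x) volume a b := fun x a b => by
    refine (intervalIntegrable_const (c := (1 : ℝ))).mono_fun (hgm x).aestronglyMeasurable ?_
    refine Eventually.of_forall fun u => ?_
    simp only [Real.norm_eq_abs, abs_one, abs_of_nonneg (hg0 x u), hg1]
  set G : ℝ → ℝ := fun x => ∫ u in (0 : ℝ)..2, g x u with hG
  have hGlim : Tendsto G atTop (𝓝 0) := by
    have := intervalIntegral.tendsto_integral_filter_of_dominated_convergence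
      (μ := volume) (a := 0) (b := 2) (l := atTop) (F := g) (f := fun _ => (0 : ℝ)) (fun _ => 1)
      (Eventually.of_forall fun x => (hgm x).aestronglyMeasurable)
      (Eventually.of_forall fun x => Eventually.of_forall fun u _ => by
        simp only [Real.norm_eq_abs, abs_of_nonneg (hg0 x u), hg1])
      intervalIntegrable_const
      (Eventually.of_forall fun u _ => by
        have h1 : Tendsto (fun x => |h (x + u) - h x|) atTop (𝓝 0) := by simpa using (ht u).abs
        simpa using (tendsto_const_nhds (x := (1 : ℝ))).min h1)
    simpa using this
  have hpart : ∀ x a b, 0 ≤ a → a ≤ b → b ≤ 2 → ∫ u in a..b, g x u ≤ G x := fun x a b h0 hab h2 =>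
    intervalIntegral.integral_mono_interval h0 hab h2
      (Eventually.of_forall fun u => hg0 x u) (hgi x 0 2)
  -- Both `[1, 2]` and its translate by `-u` lie in `[0, 2]`, so averaging the triangle
  -- inequality `|h (x + u) - h x| ≤ |h (x + v) - h x| + |h (x + v) - h (x + u)|` over
  -- `v ∈ [1, 2]` removes the dependence on `u`.
  have key : ∀ x, ∀ u ∈ Icc (0 : ℝ) 1, g x u ≤ G x + G (x + u) := fun x u hu => by
    have h1 : ∫ v in (1 : ℝ)..2, g (x + u) (v - u) ≤ G (x + u) := by
      rw [intervalIntegral.integral_comp_sub_right (fun v => g (x + u) v) u]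
      exact hpart (x + u) (1 - u) (2 - u) (by linarith [hu.2]) (by linarith) (by linarith [hu.1])
    have h2 : ∫ v in (1 : ℝ)..2, g x v ≤ G x := hpart _ _ _ (by norm_num) (by norm_num) le_rfl
    have hi : IntervalIntegrable (fun v => g (x + u) (v - u)) volume 1 2 := by
      have := (hgi (x + u) (1 - u) (2 - u)).comp_sub_right u
      simpa using this
    have h3 : ∫ v in (1 : ℝ)..2, g x u ≤ ∫ v in (1 : ℝ)..2, (g x v + g (x + u) (v - u)) := by
      refine intervalIntegral.integral_mono_on (by norm_num) intervalIntegrable_const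
        ((hgi x 1 2).add hi) fun v _ => ?_
      simp only [hg]
      rw [show x + u + (v - u) = x + v by ring]
      have htri : |h (x + u) - h x| ≤ |h (x + v) - h x| + |h (x + v) - h (x + u)| := by
        rw [abs_sub_comm (h (x + v)) (h (x + u))]
        linarith [abs_sub_le (h (x + u)) (h (x + v)) (h x)]
      rcases le_total 1 |h (x + v) - h x| with h4 | h4
      · rw [min_eq_left h4]
        exact (min_le_left _ _).trans (le_add_of_nonneg_right (le_min zero_le_one (abs_nonneg _)))
      · rcases le_total 1 |h (x + v) - h (x + u)| with h5 | h5
        · rw [min_eq_left h5]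
          exact (min_le_left _ _).trans (le_add_of_nonneg_left (le_min zero_le_one (abs_nonneg _)))
        · rw [min_eq_right h4, min_eq_right h5]
          exact (min_le_right _ _).trans htri
    rw [intervalIntegral.integral_add (hgi x 1 2) hi] at h3
    simp only [intervalIntegral.integral_const, smul_eq_mul] at h3
    linarith
  have hmin : 0 < min δ (1 / 2) := lt_min hδ (by norm_num)
  obtain ⟨X, hX⟩ := eventually_atTop.1 (hGlim.eventually (gt_mem_nhds (half_pos hmin)))
  refine ⟨X, fun x hx u hu => ?_⟩
  have h1 := key x u hu
  have h2 := hX x hx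
  have h3 := hX (x + u) (by linarith [hu.1])
  have h4 : min 1 |h (x + u) - h x| < min δ (1 / 2) := by linarith
  rcases min_lt_iff.1 h4 with h5 | h5
  · linarith [min_le_right δ (1 / 2 : ℝ)]
  · exact (h5.trans_le (min_le_left _ _)).le

/-- A slowly varying function varies more slowly than every power. -/
theorem SlowlyVarying.tendsto_log_div_log {f : ℝ → ℝ} (hf : SlowlyVarying f) :
    Tendsto (fun t => Real.log (f t) / Real.log t) atTop (𝓝 0) := by
  set h : ℝ → ℝ := fun x => Real.log (f (Real.exp x)) with hh
  have hm : Measurable h := by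
    have : Measurable fun x : ℝ => (⟨Real.exp x, Real.exp_pos x⟩ : Ioi (0 : ℝ)) :=
      Real.measurable_exp.subtype_mk
    exact Real.measurable_log.comp (hf.meas.comp this)
  have ht : ∀ u, Tendsto (fun x => h (x + u) - h x) atTop (𝓝 0) := fun u => by
    have h1 := ((hf.tendsto _ (Real.exp_pos u)).comp Real.tendsto_exp_atTop).log one_ne_zero
    rw [Real.log_one] at h1
    refine h1.congr fun x => ?_
    have hx := hf.pos _ (Real.exp_pos x)
    have hx' := hf.pos _ (mul_pos (Real.exp_pos u) (Real.exp_pos x))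
    simp only [hh, Function.comp]
    rw [Real.log_div hx'.ne' hx.ne', add_comm x u, Real.exp_add]
  have hlim : Tendsto (fun x => h x / x) atTop (𝓝 0) := by
    rw [Metric.tendsto_atTop]
    intro ε hε
    obtain ⟨X, hX⟩ := uniform_of_tendsto_sub hm ht (half_pos hε)
    have hstep : ∀ k : ℕ, |h (X + k) - h X| ≤ ε / 2 * k := fun k => by
      induction k with
      | zero => simp
      | succ k ih =>
        have h1 := hX (X + k) (by simp) 1 (by simp)
        have h2 := abs_sub_le (h (X + k + 1)) (h (X + k)) (h X)
        push_cast
        rw [← add_assoc]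
        linarith
    have hlin : ∀ x, X ≤ x → |h x| ≤ ε / 2 * (x - X) + ε / 2 + |h X| := fun x hx => by
      have h0 : 0 ≤ x - X := by linarith
      have hfl := Nat.floor_le h0
      have h1 := hX (X + ⌊x - X⌋₊) (by simp) (x - X - ⌊x - X⌋₊)
        ⟨by linarith, by linarith [(Nat.lt_floor_add_one (x - X)).le]⟩
      rw [show X + (⌊x - X⌋₊ : ℝ) + (x - X - ⌊x - X⌋₊) = x by ring] at h1
      have h2 := hstep ⌊x - X⌋₊
      have h3 : ε / 2 * (⌊x - X⌋₊ : ℝ) ≤ ε / 2 * (x - X) := by gcongr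
      have h4 := abs_add_le (h x - h (X + ⌊x - X⌋₊)) (h (X + ⌊x - X⌋₊) - h X + h X)
      have h5 := abs_add_le (h (X + ⌊x - X⌋₊) - h X) (h X)
      rw [show h x - h (X + ⌊x - X⌋₊) + (h (X + ⌊x - X⌋₊) - h X + h X) = h x by ring] at h4
      linarith
    set K := ε / 2 * |X| + ε / 2 + |h X| with hK
    have hK0 : 0 ≤ K := by positivity
    refine ⟨max (max X 1) (2 * K / ε + 1), fun x hx => ?_⟩
    have hx1 : X ≤ x := (le_max_left _ _).trans ((le_max_left _ _).trans hx)
    have hx2 : 1 ≤ x := (le_max_right _ _).trans ((le_max_left _ _).trans hx)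
    have hx3 : 2 * K / ε < x := by linarith [(le_max_right _ _).trans hx]
    rw [div_lt_iff₀ hε] at hx3
    rw [Real.dist_eq, sub_zero, abs_div, abs_of_pos (by linarith : 0 < x),
      div_lt_iff₀ (by linarith)]
    have h6 := hlin x hx1
    have h7 : ε / 2 * (-X) ≤ ε / 2 * |X| := by gcongr; exact neg_le_abs X
    nlinarith
  refine (hlim.comp Real.tendsto_log_atTop).congr' ?_
  filter_upwards [eventually_gt_atTop 0] with t ht0
  simp only [hh, Function.comp, Real.exp_log ht0]

theorem SlowlyVarying.tendsto_rpow_mul_rpow {f : ℝ → ℝ} (hf : SlowlyVarying f) {a : ℝ}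
    (ha : 0 < a) (b : ℝ) : Tendsto (fun t => t ^ a * f t ^ b) atTop atTop := by
  have h1 : Tendsto (fun t => Real.log t * (a + b * (Real.log (f t) / Real.log t))) atTop
      atTop := by
    refine Real.tendsto_log_atTop.atTop_mul_pos ha ?_
    simpa using tendsto_const_nhds.add (hf.tendsto_log_div_log.const_mul b)
  refine (Real.tendsto_exp_atTop.comp h1).congr' ?_
  filter_upwards [eventually_gt_atTop 1] with t ht
  have ht0 : 0 < t := by linarith
  have hl : Real.log t ≠ 0 := (Real.log_pos ht).ne'
  simp only [Function.comp]
  rw [Real.rpow_def_of_pos ht0, Real.rpow_def_of_pos (hf.pos t ht0), ← Real.exp_add]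
  congr 1
  field_simp

theorem SlowlyVarying.tendsto_mul_self {f : ℝ → ℝ} (hf : SlowlyVarying f) :
    Tendsto (fun t => t * f t) atTop atTop := by
  simpa using hf.tendsto_rpow_mul_rpow one_pos 1

/-! ### The Legendre transform of a power -/

/-- `γ ^ (γ / (1 - γ)) * γ` is the maximizer `γ ^ (1 / (1 - γ))` of `x ^ γ - x`; its multiple by
`q` has the `γ`-th power stated here. -/
theorem rpow_scaled {γ : ℝ} (h0 : 0 < γ) (h1 : γ < 1) {q : ℝ} (hq : 0 < q) :
    (γ ^ (γ / (1 - γ)) * γ * q) ^ γ = γ ^ (γ / (1 - γ)) * q ^ γ := by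
  have h : 1 - γ ≠ 0 := by linarith
  rw [Real.mul_rpow (by positivity) hq.le, ← Real.rpow_add_one h0.ne', ← Real.rpow_mul h0.le]
  congr 2
  field_simp
  ring

theorem rpow_sub_mul_lt {γ : ℝ} (h0 : 0 < γ) (h1 : γ < 1) {q : ℝ} (hq : 0 < q) (hq1 : q ≠ 1) :
    q ^ γ - γ * q < 1 - γ := by
  have := rpow_one_add_lt_one_add_mul_self (s := q - 1) (by linarith)
    (sub_ne_zero.2 hq1) h0 h1
  rw [add_sub_cancel] at this
  linarith

theorem exists_lt_rpow_sub {γ : ℝ} (hγ : γ ∈ Ico (0 : ℝ) 1) {ε : ℝ} (hε : 0 < ε) :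
    ∃ x, 0 < x ∧ (1 - γ) * γ ^ (γ / (1 - γ)) - ε < x ^ γ - x := by
  rcases hγ.1.eq_or_lt with rfl | h0
  · exact ⟨ε / 2, by positivity, by simp; linarith⟩
  · refine ⟨γ ^ (γ / (1 - γ)) * γ * 1, by positivity, ?_⟩
    rw [rpow_scaled h0 hγ.2 one_pos, Real.one_rpow]
    linarith

/-- Points for the Tauberian direction. `x` is slightly to the right of the maximizer of
`x ^ γ - x`; tilting to `s < x` makes the contribution of the integral above `1` (in rescaled
units) exponentially negligible, and tilting to `s > x` does so for the contribution below `a`.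
For `γ = 0` one takes `a = 0`, where nothing lies below. -/
theorem exists_tilting_points {γ : ℝ} (hγ : γ ∈ Ico (0 : ℝ) 1) {ε : ℝ} (hε : 0 < ε) :
    ∃ x s₁ a, 0 < s₁ ∧ s₁ < x ∧ 0 ≤ a ∧ a ≤ 1 ∧
      x ^ γ - x * a < (1 - γ) * γ ^ (γ / (1 - γ)) + ε ∧ x ^ γ - x < s₁ ^ γ - s₁ ∧
      (a = 0 ∨ ∃ s₂, x < s₂ ∧ x ^ γ - x * a < s₂ ^ γ - s₂ * a) := by
  rcases hγ.1.eq_or_lt with rfl | h0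
  · exact ⟨2, 1, 0, by norm_num, by norm_num, le_rfl, zero_le_one, by simpa using hε,
      by norm_num, Or.inl rfl⟩
  set w := γ ^ (γ / (1 - γ)) with hw
  have hw0 : 0 < w := by positivity
  have hcont : Tendsto (fun q : ℝ => w * (q ^ γ - γ * q ^ (2 * γ - 1))) (𝓝[>] 1)
      (𝓝 (w * (1 - γ))) := by
    have : ContinuousAt (fun q : ℝ => w * (q ^ γ - γ * q ^ (2 * γ - 1))) 1 :=
      ((Real.continuousAt_rpow_const 1 γ (Or.inl one_ne_zero)).sub
        ((Real.continuousAt_rpow_const 1 (2 * γ - 1) (Or.inl one_ne_zero)).const_mul γ)).const_mul w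
    simpa [ContinuousAt] using this.tendsto.mono_left nhdsWithin_le_nhds
  obtain ⟨q, hqε, hq⟩ := ((hcont.eventually (gt_mem_nhds (lt_add_of_pos_right _ hε))).and
    self_mem_nhdsWithin).exists
  have hq1 : 1 < q := hq
  have hq0 : 0 < q := by linarith
  -- The slope `a` is chosen so that `s ^ γ - s a` is maximal at `s = w γ q ^ 2`.
  have e1 : q * q ^ (2 * γ - 2) = q ^ (2 * γ - 1) := by
    rw [mul_comm, ← Real.rpow_add_one hq0.ne']; congr 1; ring
  have e2 : q ^ 2 * q ^ (2 * γ - 2) = q ^ (2 * γ) := by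
    rw [← Real.rpow_natCast, ← Real.rpow_add hq0]; congr 1; push_cast; ring
  have e3 : (q ^ 2) ^ γ = q ^ (2 * γ) := by
    rw [← Real.rpow_natCast, ← Real.rpow_mul hq0.le]; norm_num
  have e4 : q ^ (2 * γ) * (q⁻¹) ^ γ = q ^ γ := by
    rw [Real.inv_rpow hq0.le, ← Real.rpow_neg hq0.le, ← Real.rpow_add hq0]; congr 1; ring
  have e5 : q ^ (2 * γ) * q⁻¹ = q ^ (2 * γ - 1) := by
    rw [← Real.rpow_neg_one, ← Real.rpow_add hq0]; congr 1
  have hxa : w * γ * q * q ^ (2 * γ - 2) = w * γ * q ^ (2 * γ - 1) := by rw [mul_assoc, e1]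
  refine ⟨w * γ * q, w * γ * 1, q ^ (2 * γ - 2), by positivity, by gcongr, by positivity,
    Real.rpow_le_one_of_one_le_of_nonpos hq1.le (by linarith [hγ.2]), ?_, ?_,
    Or.inr ⟨w * γ * q ^ 2, by gcongr; nlinarith, ?_⟩⟩
  · rw [rpow_scaled h0 hγ.2 hq0, hxa]
    linarith
  · rw [rpow_scaled h0 hγ.2 hq0, rpow_scaled h0 hγ.2 one_pos, Real.one_rpow]
    nlinarith [mul_lt_mul_of_pos_left (rpow_sub_mul_lt h0 hγ.2 hq0 hq1.ne') hw0]
  · rw [rpow_scaled h0 hγ.2 hq0, rpow_scaled h0 hγ.2 (by positivity), hxa, mul_assoc (w * γ), e2,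
      e3, ← hw]
    have h2 := rpow_sub_mul_lt h0 hγ.2 (inv_pos.2 hq0) (inv_lt_one_of_one_lt₀ hq1).ne
    have h3 := mul_lt_mul_of_pos_left h2 (by positivity : 0 < w * q ^ (2 * γ))
    have h4 : w * q ^ (2 * γ) * (q⁻¹ ^ γ - γ * q⁻¹) =
        w * (q ^ (2 * γ) * q⁻¹ ^ γ) - w * γ * (q ^ (2 * γ) * q⁻¹) := by ring
    rw [h4, e4, e5] at h3
    linarith

theorem exists_add_lt {γ : ℝ} (hγ : γ ∈ Ico (0 : ℝ) 1) {ε : ℝ} (hε : 0 < ε) :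
    ∃ x, 0 < x ∧ x + (1 - γ) * (γ / x) ^ (γ / (1 - γ)) < 1 + ε := by
  rcases hγ.1.eq_or_lt with rfl | h0
  · exact ⟨ε / 2, by positivity, by simp; linarith⟩
  · refine ⟨γ, h0, ?_⟩
    rw [div_self h0.ne', Real.one_rpow]
    linarith

/-- Weighted arithmetic-geometric mean inequality; equality holds at `x = γ`. -/
theorem one_le_add {γ : ℝ} (hγ : γ ∈ Ico (0 : ℝ) 1) {x : ℝ} (hx : 0 < x) :
    1 ≤ x + (1 - γ) * (γ / x) ^ (γ / (1 - γ)) := by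
  rcases hγ.1.eq_or_lt with rfl | h0
  · simp [hx.le]
  have h1 : 0 < 1 - γ := by linarith [hγ.2]
  have hp : 0 < γ / x := by positivity
  have := Real.geom_mean_le_arith_mean2_weighted h0.le h1.le (inv_pos.2 hp).le
    (Real.rpow_nonneg hp.le (γ / (1 - γ))) (by ring)
  rw [← Real.rpow_mul hp.le, div_mul_cancel₀ _ h1.ne', Real.inv_rpow hp.le,
    inv_mul_cancel₀ (by positivity)] at this
  have h2 : γ * (γ / x)⁻¹ = x := by field_simp
  linarith

/-! ### Exponential rates -/

section Asymptotics

variable {α : Type*} {l : Filter α} {A B Φ : α → ℝ}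

theorem eventually_pos_of_tendsto_log {b : ℝ} (hB : ∀ u, 0 ≤ B u) (hb : b ≠ 0)
    (h : Tendsto (fun u => -Real.log (B u) / Φ u) l (𝓝 b)) : ∀ᶠ u in l, 0 < B u := by
  filter_upwards [h.eventually_ne hb] with u hu
  refine (hB u).lt_of_ne fun h0 => hu ?_
  simp [← h0]

/-- If `A` and `B` decay with exponential rates `a` and `b` at speed `Φ → ∞`, and `b < c + a`,
then `exp (-c Φ) A` is negligible with respect to `B`. -/
theorem eventually_exp_mul_le {a b c : ℝ} (hΦ : Tendsto Φ l atTop) (hA : ∀ u, 0 ≤ A u)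
    (hB : ∀ᶠ u in l, 0 < B u) (ha : Tendsto (fun u => -Real.log (A u) / Φ u) l (𝓝 a))
    (hb : Tendsto (fun u => -Real.log (B u) / Φ u) l (𝓝 b)) (hlt : b < c + a) :
    ∀ᶠ u in l, Real.exp (-(c * Φ u)) * A u ≤ B u / 4 := by
  have hδ : 0 < (c + a - b) / 3 := by linarith
  filter_upwards [hB, ha.eventually (lt_mem_nhds (sub_lt_self a hδ)),
    hb.eventually (gt_mem_nhds (lt_add_of_pos_right b hδ)), hΦ.eventually_gt_atTop 0,
    hΦ.eventually_ge_atTop (Real.log 4 / ((c + a - b) / 3))] with u hBu hau hbu h0 h4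
  rcases (hA u).eq_or_lt with hA0 | hA0
  · rw [← hA0, mul_zero]; positivity
  rw [lt_div_iff₀ h0] at hau
  rw [div_lt_iff₀ h0] at hbu
  rw [div_le_iff₀ hδ] at h4
  rw [← Real.exp_log hA0, ← Real.exp_log hBu, ← Real.exp_add, le_div_iff₀ (by norm_num),
    ← Real.exp_log (by norm_num : (0 : ℝ) < 4), ← Real.exp_add, Real.exp_le_exp]
  nlinarith

end Asymptotics

namespace IsLaplacePair

variable {ρ : Measure ℝ} {F n : ℝ → ℝ} {τ : ℝ} {α : Type*} {l : Filter α} {T E Φ : α → ℝ} {γ : ℝ}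

/-- Abelian half at speed `Φ = T E → ∞`: exponential rates of the distribution function at all
fixed multiples of `E` give the rate of the transform at `T`. -/
theorem abelian (h : IsLaplacePair ρ F n τ) (hγ : γ ∈ Ico (0 : ℝ) 1) (hT : Tendsto T l atTop)
    (hE : ∀ᶠ u in l, 0 < E u) (hΦ : Tendsto Φ l atTop) (hTE : ∀ᶠ u in l, T u * E u = Φ u)
    (hn : ∀ x, 0 < x → Tendsto (fun u => -Real.log (n (x * E u)) / Φ u) l
      (𝓝 ((1 - γ) * (γ / x) ^ (γ / (1 - γ))))) :
    Tendsto (fun u => -Real.log (F (T u)) / Φ u) l (𝓝 1) := by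
  have h1γ : 0 < 1 - γ := by linarith [hγ.2]
  have hnpos : ∀ x, 0 < x → ∀ᶠ u in l, 0 < n (x * E u) := fun x hx => by
    refine eventually_pos_of_tendsto_log (fun u => h.distrib_nonneg _) ?_ (hn x hx)
    rcases hγ.1.eq_or_lt with rfl | h0
    · simp
    · positivity
  have hupper : ∀ x, 0 < x → ∀ᶠ u in l, 0 < F (T u) ∧
      -Real.log (F (T u)) / Φ u ≤ x + -Real.log (n (x * E u)) / Φ u := fun x hx => by
    filter_upwards [hnpos x hx, hT.eventually_ge_atTop τ, hΦ.eventually_gt_atTop 0, hTE]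
      with u hnu hTu hΦu hTEu
    have h1 := h.exp_mul_le hTu (x * E u)
    have h2 := mul_pos (Real.exp_pos (-(T u * (x * E u)))) hnu
    refine ⟨h2.trans_le h1, ?_⟩
    have h3 := Real.log_le_log h2 h1
    rw [Real.log_mul (Real.exp_pos _).ne' hnu.ne', Real.log_exp,
      show T u * (x * E u) = x * Φ u by rw [← hTEu]; ring] at h3
    rw [div_le_iff₀ hΦu, add_mul, div_mul_cancel₀ _ hΦu.ne']
    linarith
  rw [tendsto_order]
  refine ⟨fun a ha => ?_, fun a ha => ?_⟩
  · obtain ⟨ε, hε, rfl⟩ : ∃ ε, 0 < ε ∧ a = 1 - 3 * ε := ⟨(1 - a) / 3, by linarith, by ring⟩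
    obtain ⟨k, hk⟩ := exists_nat_ge (1 / ε)
    rw [div_le_iff₀ hε] at hk
    have hB : Tendsto (fun u => -Real.log (Real.exp (-((1 - 2 * ε) * Φ u))) / Φ u) l
        (𝓝 (1 - 2 * ε)) := by
      refine tendsto_const_nhds.congr' ?_
      filter_upwards [hΦ.eventually_gt_atTop 0] with u hu
      rw [Real.log_exp, neg_neg, mul_div_cancel_right₀ _ hu.ne']
    -- The rate of the `i`-th summand is within `ε` of `x + (1 - γ) (γ / x) ^ (γ / (1 - γ))` at
    -- `x = (i + 1) ε`, hence at least `1 - ε`.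
    have hterm : ∀ i ∈ Finset.range k, ∀ᶠ u in l,
        Real.exp (-(i * ε * Φ u)) * n ((i + 1) * ε * E u) ≤
          Real.exp (-((1 - 2 * ε) * Φ u)) / 4 := fun i _ => by
      have hx : 0 < (i + 1) * ε := by positivity
      refine eventually_exp_mul_le hΦ (fun u => h.distrib_nonneg _)
        (Eventually.of_forall fun u => Real.exp_pos _) (hn _ hx) hB ?_
      linarith [one_le_add hγ hx]
    set C : ℝ := k + F τ + 1 with hC
    have hC0 : 0 < C := by have := h.transform_nonneg τ; positivity
    have hconst : Tendsto (fun u => 1 - 2 * ε - Real.log C / Φ u) l (𝓝 (1 - 2 * ε)) := by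
      simpa using tendsto_const_nhds.sub (tendsto_const_nhds.div_atTop hΦ)
    filter_upwards [(Finset.eventually_all _).2 hterm, hupper 1 one_pos,
      hT.eventually_ge_atTop τ, hT.eventually_gt_atTop 0, hT.eventually_ge_atTop (τ * k),
      hΦ.eventually_gt_atTop 0, hTE, hE,
      hconst.eventually (lt_mem_nhds (by linarith : 1 - 3 * ε < 1 - 2 * ε))]
      with u hi hF hτ hT0 hk' hΦu hTEu hEu hlast
    refine hlast.trans_le ?_
    have hsum := h.le_sum hτ (by positivity : 0 ≤ ε * E u) k
    have hS : ∑ i ∈ Finset.range k, Real.exp (-(T u * (i * (ε * E u)))) *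
        n ((i + 1) * (ε * E u)) ≤ k * Real.exp (-((1 - 2 * ε) * Φ u)) := by
      rw [← nsmul_eq_mul]
      refine (Finset.sum_le_card_nsmul _ _ _ fun i hik => ?_).trans_eq (by rw [Finset.card_range])
      have := hi i hik
      rw [show T u * (i * (ε * E u)) = i * ε * Φ u by rw [← hTEu]; ring, ← mul_assoc]
      linarith [Real.exp_pos (-((1 - 2 * ε) * Φ u))]
    have hR : Real.exp (-((T u - τ) * (k * (ε * E u)))) * F τ ≤
        Real.exp (-((1 - 2 * ε) * Φ u)) * F τ := by
      refine mul_le_mul_of_nonneg_right (Real.exp_le_exp.2 (neg_le_neg ?_)) (h.transform_nonneg _)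
      have h5 : τ * k * (ε * E u) ≤ T u * (ε * E u) := by gcongr
      have h6 : 1 * Φ u ≤ k * ε * Φ u := by gcongr
      have h7 := mul_pos hε hΦu
      rw [← hTEu] at h6 h7 ⊢
      nlinarith
    have hfin : F (T u) ≤ C * Real.exp (-((1 - 2 * ε) * Φ u)) := by
      rw [hC]
      nlinarith [Real.exp_pos (-((1 - 2 * ε) * Φ u))]
    have hlog := Real.log_le_log hF.1 hfin
    rw [Real.log_mul hC0.ne' (Real.exp_pos _).ne', Real.log_exp] at hlog
    rw [le_div_iff₀ hΦu, sub_mul, div_mul_cancel₀ _ hΦu.ne']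
    linarith
  · obtain ⟨x, hx, hxa⟩ := exists_add_lt hγ (sub_pos.2 ha)
    rw [add_sub_cancel] at hxa
    filter_upwards [hupper x hx, ((hn x hx).const_add x).eventually (gt_mem_nhds hxa)] with u h1 h2
    exact h1.2.trans_lt h2

/-- Tauberian half at speed `Φ = T E → ∞`: exponential rates of the transform at all fixed
multiples of `T` give the rate of the distribution function at `E`. -/
theorem tauberian (h : IsLaplacePair ρ F n τ) (hγ : γ ∈ Ico (0 : ℝ) 1) (hT : Tendsto T l atTop)
    (hE : ∀ᶠ u in l, 0 < E u) (hΦ : Tendsto Φ l atTop) (hTE : ∀ᶠ u in l, T u * E u = Φ u)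
    (hF : ∀ x, 0 < x → Tendsto (fun u => -Real.log (F (x * T u)) / Φ u) l (𝓝 (x ^ γ))) :
    Tendsto (fun u => -Real.log (n (E u)) / Φ u) l (𝓝 ((1 - γ) * γ ^ (γ / (1 - γ)))) := by
  have hFpos : ∀ x, 0 < x → ∀ᶠ u in l, 0 < F (x * T u) := fun x hx =>
    eventually_pos_of_tendsto_log (fun u => h.transform_nonneg _)
      (Real.rpow_pos_of_pos hx γ).ne' (hF x hx)
  have hxT : ∀ x, 0 < x → ∀ᶠ u in l, τ ≤ x * T u := fun x hx =>
    (hT.const_mul_atTop hx).eventually_ge_atTop τ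
  have hupper : ∀ ε, 0 < ε → ∀ᶠ u in l, 0 < n (E u) ∧
      -Real.log (n (E u)) / Φ u < (1 - γ) * γ ^ (γ / (1 - γ)) + ε := fun ε hε => by
    obtain ⟨x, s₁, a, hs₁, hs₁x, ha0, ha1, hxa, hx₁, hx₂⟩ := exists_tilting_points hγ hε
    have hx : 0 < x := hs₁.trans hs₁x
    have hmain : ∀ᶠ u in l, F (x * T u) / 2 ≤ Real.exp (-(x * a * Φ u)) * n (E u) := by
      have hhigh := eventually_exp_mul_le (c := x - s₁) hΦ (fun u => h.transform_nonneg _)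
        (hFpos x hx) (hF s₁ hs₁) (hF x hx) (by linarith)
      rcases hx₂ with rfl | ⟨s₂, hs₂, hx₂⟩
      · filter_upwards [hhigh, hFpos x hx, hxT s₁ hs₁, hE, hTE, hT.eventually_ge_atTop 0]
          with u h1 h2 h3 h4 h5 h6
        have := h.le_two h3 (mul_le_mul_of_nonneg_right hs₁x.le h6) h4.le
        rw [show (x * T u - s₁ * T u) * E u = (x - s₁) * Φ u by rw [← h5]; ring] at this
        simp only [mul_zero, zero_mul, neg_zero, Real.exp_zero, one_mul]
        linarith
      · have hlow := eventually_exp_mul_le (c := -((s₂ - x) * a)) hΦ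
          (fun u => h.transform_nonneg _) (hFpos x hx) (hF s₂ (hx.trans hs₂)) (hF x hx)
          (by linarith)
        filter_upwards [hhigh, hlow, hFpos x hx, hxT s₁ hs₁, hE, hTE, hT.eventually_ge_atTop 0]
          with u h1 h1' h2 h3 h4 h5 h6
        have := h.le_three h3 (mul_le_mul_of_nonneg_right hs₁x.le h6)
          (mul_le_mul_of_nonneg_right hs₂.le h6) (mul_le_of_le_one_left h4.le ha1)
        rw [show (x * T u - s₁ * T u) * E u = (x - s₁) * Φ u by rw [← h5]; ring,
          show (s₂ * T u - x * T u) * (a * E u) = -(-((s₂ - x) * a) * Φ u) by rw [← h5]; ring,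
          show x * T u * (a * E u) = x * a * Φ u by rw [← h5]; ring] at this
        linarith
    have hlim : Tendsto (fun u => -Real.log (F (x * T u)) / Φ u - x * a + Real.log 2 / Φ u) l
        (𝓝 (x ^ γ - x * a)) := by
      simpa using ((hF x hx).sub_const (x * a)).add (tendsto_const_nhds.div_atTop hΦ)
    filter_upwards [hmain, hFpos x hx, hΦ.eventually_gt_atTop 0,
      hlim.eventually (gt_mem_nhds hxa)] with u h1 h2 h3 h4
    have hn : 0 < n (E u) := pos_of_mul_pos_right ((half_pos h2).trans_le h1) (Real.exp_pos _).le
    refine ⟨hn, lt_of_le_of_lt ?_ h4⟩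
    have hlog := Real.log_le_log (half_pos h2) h1
    rw [Real.log_mul (Real.exp_pos _).ne' hn.ne', Real.log_exp,
      Real.log_div h2.ne' two_ne_zero] at hlog
    rw [div_le_iff₀ h3, add_mul, sub_mul, div_mul_cancel₀ _ h3.ne', div_mul_cancel₀ _ h3.ne']
    linarith
  rw [tendsto_order]
  refine ⟨fun b hb => ?_, fun b hb => ?_⟩
  · obtain ⟨x, hx, hxb⟩ := exists_lt_rpow_sub hγ (sub_pos.2 hb)
    rw [sub_sub_cancel] at hxb
    filter_upwards [hupper 1 one_pos, hxT x hx, hTE, hΦ.eventually_gt_atTop 0,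
      ((hF x hx).sub_const x).eventually (lt_mem_nhds hxb)] with u h1 h2 h3 h4 h5
    refine h5.trans_le ?_
    have h6 := Real.log_le_log (mul_pos (Real.exp_pos _) h1.1) (h.exp_mul_le h2 (E u))
    rw [Real.log_mul (Real.exp_pos _).ne' h1.1.ne', Real.log_exp,
      show x * T u * E u = x * Φ u by rw [← h3]; ring] at h6
    rw [le_div_iff₀ h4, sub_mul, div_mul_cancel₀ _ h4.ne']
    linarith
  · filter_upwards [hupper _ (sub_pos.2 hb)] with u hu
    linarith [hu.2]

end IsLaplacePair

/-! ### The shifted measure -/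

/-- The shifted transform and the translated distribution function form a Laplace pair, for the
translate of `μ` by `-η` restricted to `[0, ∞[`. -/
theorem isLaplacePair_shift {μ : Measure ℝ} {N : ℝ → ℝ} (hN : IsDistributionFunction N μ)
    {η τ : ℝ} (hη : N η = 0) (hτ : 0 < τ) (hfin : shiftedLaplace μ η τ < ⊤) :
    IsLaplacePair ((μ.map fun x => x - η).restrict (Ici 0))
      (fun t => (shiftedLaplace μ η t).toReal) (fun E => N (η + E)) τ := by
  have hm : Measurable fun x : ℝ => x - η := by fun_prop
  have hIio : ∀ E, (μ.map fun x => x - η) (Iio E) = μ (Iio (η + E)) := fun E => by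
    rw [Measure.map_apply hm measurableSet_Iio]
    congr 1; ext x; simp [add_comm η]
  have hIic : ∀ E, (μ.map fun x => x - η) (Iic E) = μ (Iic (η + E)) := fun E => by
    rw [Measure.map_apply hm measurableSet_Iic]
    congr 1; ext x; simp [add_comm η]
  have hnull : (μ.map fun x => x - η) (Iio 0) = 0 := by
    rw [hIio, add_zero]
    rcases hN.2 with h | h
    · rw [h, hη, ENNReal.ofReal_zero]
    · refine measure_mono_null Iio_subset_Iic_self ?_
      rw [h, hη, ENNReal.ofReal_zero]
  refine ⟨hτ, fun _ => ENNReal.toReal_nonneg, fun E => hN.1 _, ?_, fun t ht => ?_, fun E => ?_,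
    fun E => ?_⟩
  · rw [Measure.restrict_apply measurableSet_Iio]
    exact measure_mono_null inter_subset_left hnull
  · rw [ENNReal.ofReal_toReal, shiftedLaplace_eq]
    refine ne_top_of_le_ne_top hfin.ne ?_
    rw [shiftedLaplace_eq, shiftedLaplace_eq]
    refine setLIntegral_mono' measurableSet_Ici fun x hx => ?_
    have : τ * x ≤ t * x := mul_le_mul_of_nonneg_right ht hx
    gcongr
  · refine (Measure.restrict_apply_le _ _).trans ?_
    rw [hIio]
    rcases hN.2 with h | h
    · exact (h _).le
    · exact (measure_mono Iio_subset_Iic_self).trans (h _).le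
  · rw [Measure.restrict_apply measurableSet_Iic]
    have h1 : ENNReal.ofReal (N (η + E)) ≤ (μ.map fun x => x - η) (Iic E) := by
      rw [hIic]
      rcases hN.2 with h | h
      · rw [← h]; exact measure_mono Iio_subset_Iic_self
      · exact (h _).ge
    refine h1.trans ?_
    calc _ ≤ (μ.map fun x => x - η) (Iic E ∩ Ici 0 ∪ Iio 0) := by
          refine measure_mono fun x hx => ?_
          rcases le_or_gt 0 x with h | h
          · exact Or.inl ⟨hx, h⟩
          · exact Or.inr h
      _ ≤ _ := (measure_union_le _ _).trans (by rw [hnull, add_zero])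

/-! ### Passing to the conjugate scale -/

theorem SlowlyVarying.tendsto_mul_comp {α : Type*} {l : Filter α} {f : ℝ → ℝ} {T g : α → ℝ}
    (hf : SlowlyVarying f) (hT : Tendsto T l atTop)
    (h : Tendsto (fun u => g u * f (T u)) l (𝓝 1)) {c : ℝ} (hc : 0 < c) :
    Tendsto (fun u => g u * f (c * T u)) l (𝓝 1) := by
  have h1 := h.mul ((hf.tendsto c hc).comp hT)
  rw [one_mul] at h1
  refine h1.congr' ?_
  filter_upwards [hT.eventually_gt_atTop 0] with u hu
  have := (hf.pos _ hu).ne'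
  simp only [Function.comp]
  field_simp

theorem one_sub_mul_rpow_ne_zero {γ : ℝ} (hγ : γ ∈ Ico (0 : ℝ) 1) :
    (1 - γ) * γ ^ (γ / (1 - γ)) ≠ 0 := by
  rcases hγ.1.eq_or_lt with rfl | h0
  · simp
  · have : 0 < 1 - γ := by linarith [hγ.2]
    positivity

namespace IsLaplacePair

variable {ρ : Measure ℝ} {F n f g : ℝ → ℝ} {τ γ : ℝ}

/-- Tauberian implication, for a speed tending to infinity. -/
theorem asympEquiv_distrib (h : IsLaplacePair ρ F n τ) (hγ : γ ∈ Ico (0 : ℝ) 1)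
    (hf : DeBruijnConjugatePair f g) (hΦ : Tendsto (fun u => u ^ γ * g u) atTop atTop)
    (hL : AsympEquiv atTop (fun t => Real.log (F t)) (fun t => -(t ^ γ * (f t) ^ (γ - 1)))) :
    AsympEquiv (𝓝[>] (0 : ℝ)) (fun E => Real.log (n E))
      (fun E => -((1 - γ) * (γ / E) ^ (γ / (1 - γ)) * g (E ^ (1 / (γ - 1))))) := by
  have h1 : γ - 1 < 0 := by linarith [hγ.2]
  have h1' : 1 - γ ≠ 0 := by linarith
  set U : ℝ → ℝ := fun E => E ^ (1 / (γ - 1)) with hU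
  have hUlim : Tendsto U (𝓝[>] 0) atTop :=
    tendsto_rpow_neg_nhdsGT_zero (one_div_neg.2 h1)
  have hpos : ∀ᶠ E in 𝓝[>] (0 : ℝ), 0 < E := self_mem_nhdsWithin
  have hUE : ∀ E, 0 < E → U E * E = U E ^ γ := fun E hE => by
    simp only [hU]
    rw [← Real.rpow_add_one hE.ne', ← Real.rpow_mul hE.le]
    congr 1; field_simp [h1.ne]; ring
  have hTlim : Tendsto (fun E => U E * g (U E)) (𝓝[>] 0) atTop :=
    hf.slow_right.tendsto_mul_self.comp hUlim
  -- The scale is `u = E ^ (1 / (γ - 1))`, at which `t = u g(u)` satisfies `t f(t) ~ u`.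
  have hmain := h.tauberian (l := 𝓝[>] 0) (T := fun E => U E * g (U E)) (E := id)
    (Φ := fun E => U E ^ γ * g (U E)) hγ hTlim hpos (hΦ.comp hUlim) (by
      filter_upwards [hpos] with E hE
      rw [← hUE E hE, id]; ring) (fun x hx => by
      have e1 := hL.comp (hTlim.const_mul_atTop hx)
      have e2 := hf.slow_left.tendsto_mul_comp hTlim (hf.tendsto_right.comp hUlim) hx
      have e3 := (e1.mul (e2.rpow_const (p := γ - 1) (Or.inl one_ne_zero))).mul_const (x ^ γ)
      simp only [Real.one_rpow, one_mul] at e3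
      refine e3.congr' ?_
      filter_upwards [hpos, hTlim.eventually_gt_atTop 0] with E hE hT
      have hU0 : 0 < U E := Real.rpow_pos_of_pos hE _
      have hg0 := hf.slow_right.pos _ hU0
      have hf0 := hf.slow_left.pos _ (mul_pos hx hT)
      simp only [Function.comp]
      rw [Real.mul_rpow hx.le hT.le, Real.mul_rpow hg0.le hf0.le]
      have e4 : (U E * g (U E)) ^ γ = U E ^ γ * g (U E) * g (U E) ^ (γ - 1) := by
        rw [Real.mul_rpow hU0.le hg0.le, mul_assoc, mul_comm (g (U E)),
          ← Real.rpow_add_one hg0.ne', sub_add_cancel]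
      rw [e4]
      have := (Real.rpow_pos_of_pos hf0 (γ - 1)).ne'
      have := (Real.rpow_pos_of_pos hg0 (γ - 1)).ne'
      have := (Real.rpow_pos_of_pos hx γ).ne'
      have := (Real.rpow_pos_of_pos hU0 γ).ne'
      have := hg0.ne'
      generalize f (x * (U E * g (U E))) ^ (γ - 1) = A at *
      generalize Real.log (F (x * (U E * g (U E)))) = X
      field_simp)
  have hr := one_sub_mul_rpow_ne_zero hγ
  have hfin := hmain.div_const ((1 - γ) * γ ^ (γ / (1 - γ)))
  rw [div_self hr] at hfin
  refine hfin.congr' ?_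
  filter_upwards [hpos] with E hE
  have e5 : (γ / E) ^ (γ / (1 - γ)) = γ ^ (γ / (1 - γ)) * U E ^ γ := by
    rw [Real.div_rpow hγ.1 hE.le, div_eq_mul_inv, ← Real.rpow_neg hE.le, hU, ← Real.rpow_mul hE.le]
    congr 2
    rw [← neg_sub 1 γ]
    field_simp
  rw [e5, id, div_div, ← neg_div_neg_eq, neg_neg]
  congr 2
  ring

/-- Abelian implication, for a speed tending to infinity. -/
theorem asympEquiv_transform (h : IsLaplacePair ρ F n τ) (hγ : γ ∈ Ico (0 : ℝ) 1)
    (hf : DeBruijnConjugatePair f g) (hΦ : Tendsto (fun t => t ^ γ * f t ^ (γ - 1)) atTop atTop)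
    (hR : AsympEquiv (𝓝[>] (0 : ℝ)) (fun E => Real.log (n E))
      (fun E => -((1 - γ) * (γ / E) ^ (γ / (1 - γ)) * g (E ^ (1 / (γ - 1)))))) :
    AsympEquiv atTop (fun t => Real.log (F t)) (fun t => -(t ^ γ * (f t) ^ (γ - 1))) := by
  have h1 : γ - 1 < 0 := by linarith [hγ.2]
  have h1' : 1 - γ ≠ 0 := by linarith
  set U : ℝ → ℝ := fun t => t * f t with hU
  have hUlim : Tendsto U atTop atTop := hf.slow_left.tendsto_mul_self
  have hElim : ∀ x, 0 < x → Tendsto (fun t => x * U t ^ (γ - 1)) atTop (𝓝[>] 0) := fun x hx => by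
    refine tendsto_nhdsWithin_iff.2 ⟨?_, ?_⟩
    · have := ((tendsto_rpow_neg_atTop (neg_pos.2 h1)).comp hUlim).const_mul x
      simpa using this
    · filter_upwards [hUlim.eventually_gt_atTop 0] with t ht
      exact mul_pos hx (Real.rpow_pos_of_pos ht _)
  -- The scale is `u = t f(t)`, at which `g(u) ~ 1 / f(t)`; the matching `E` is `u ^ (γ - 1)`.
  have hmain := h.abelian (l := atTop) (T := id) (E := fun t => U t ^ (γ - 1))
    (Φ := fun t => t ^ γ * f t ^ (γ - 1)) hγ tendsto_id (by
      filter_upwards [hUlim.eventually_gt_atTop 0] with t ht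
      exact Real.rpow_pos_of_pos ht _) hΦ (by
      filter_upwards [eventually_gt_atTop 0] with t ht
      rw [id, hU, Real.mul_rpow ht.le (hf.slow_left.pos t ht).le, ← mul_assoc, mul_comm t,
        ← Real.rpow_add_one ht.ne', sub_add_cancel]) (fun x hx => by
      have e1 := hR.comp (hElim x hx)
      have hc : 0 < x ^ (1 / (γ - 1)) := Real.rpow_pos_of_pos hx _
      have e2 := hf.slow_right.tendsto_mul_comp hUlim hf.tendsto_left hc
      have e3 := (e1.mul e2).mul_const ((1 - γ) * (γ / x) ^ (γ / (1 - γ)))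
      simp only [one_mul] at e3
      have hr : (1 - γ) * (γ / x) ^ (γ / (1 - γ)) ≠ 0 := by
        rw [Real.div_rpow hγ.1 hx.le, ← mul_div_assoc]
        exact div_ne_zero (one_sub_mul_rpow_ne_zero hγ) (Real.rpow_pos_of_pos hx _).ne'
      refine e3.congr' ?_
      filter_upwards [eventually_gt_atTop 0] with t ht
      have hf0 := hf.slow_left.pos t ht
      have hU0 : 0 < U t := mul_pos ht hf0
      have hg0 := hf.slow_right.pos _ (mul_pos hc hU0)
      simp only [Function.comp]
      have e4 : (x * U t ^ (γ - 1)) ^ (1 / (γ - 1)) = x ^ (1 / (γ - 1)) * U t := by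
        rw [Real.mul_rpow hx.le (Real.rpow_pos_of_pos hU0 _).le, ← Real.rpow_mul hU0.le,
          mul_one_div_cancel h1.ne, Real.rpow_one]
      have e5 : (γ / (x * U t ^ (γ - 1))) ^ (γ / (1 - γ)) =
          (γ / x) ^ (γ / (1 - γ)) * (t ^ γ * f t ^ (γ - 1) * f t) := by
        rw [← div_div, Real.div_rpow (div_nonneg hγ.1 hx.le) (Real.rpow_pos_of_pos hU0 _).le,
          div_eq_mul_inv, ← Real.rpow_neg (Real.rpow_pos_of_pos hU0 _).le, ← Real.rpow_mul hU0.le,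
          mul_assoc, ← Real.rpow_add_one hf0.ne', sub_add_cancel,
          ← Real.mul_rpow ht.le hf0.le]
        congr 2
        field_simp
        ring
      rw [e4, e5]
      have := (Real.rpow_pos_of_pos hf0 (γ - 1)).ne'
      have := (Real.rpow_pos_of_pos ht γ).ne'
      rw [mul_ne_zero_iff] at hr
      obtain ⟨hr1, hr2⟩ := hr
      field_simp)
  refine hmain.congr fun t => ?_
  rw [id, ← neg_div_neg_eq, neg_neg]

end IsLaplacePair

/-! ### The case `γ = 0` and the equivalence -/

/-- If `X → 0`, then `log X ~ -G` forces `G → ∞`. The junk value `log 0 = 0` is harmless: it is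
excluded by the equivalence. -/
theorem AsympEquiv.tendsto_atTop_of_log {l : Filter ℝ} {X G : ℝ → ℝ}
    (h : AsympEquiv l (fun x => Real.log (X x)) fun x => -G x) (hX : Tendsto X l (𝓝 0)) :
    Tendsto G l atTop := by
  have hne : ∀ᶠ x in l, Real.log (X x) ≠ 0 := by
    filter_upwards [h.eventually_ne one_ne_zero] with x hx h0
    simp [h0] at hx
  have hX' : Tendsto X l (𝓝[≠] 0) := tendsto_nhdsWithin_iff.2 ⟨hX, by
    filter_upwards [hne] with x hx h0
    exact hx (by rw [mem_singleton_iff.1 h0, Real.log_zero])⟩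
  have hlog := tendsto_neg_atBot_atTop.comp (Real.tendsto_log_nhdsNE_zero.comp hX')
  refine (hlog.atTop_mul_pos one_pos (by simpa using h.inv₀ one_ne_zero)).congr' ?_
  filter_upwards [hne] with x hx
  simp only [Function.comp]
  rcases eq_or_ne (G x) 0 with h0 | h0
  · simp [h0]
  · field_simp

/-- If `X` decreases to `c > 0`, then `log X ~ -G` with `G > 0` forces `c < 1`: otherwise the
quotient would be nonpositive. -/
theorem AsympEquiv.tendsto_of_log {l : Filter ℝ} [l.NeBot] {X G : ℝ → ℝ} {c : ℝ}
    (h : AsympEquiv l (fun x => Real.log (X x)) fun x => -G x) (hX : Tendsto X l (𝓝 c))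
    (hc : 0 < c) (hcX : ∀ᶠ x in l, c ≤ X x) (hG : ∀ᶠ x in l, 0 < G x) :
    Tendsto G l (𝓝 (-Real.log c)) ∧ 0 < -Real.log c := by
  have hlim : Tendsto G l (𝓝 (-Real.log c)) := by
    have h1 := ((hX.log hc.ne').neg).mul (h.inv₀ one_ne_zero)
    simp only [inv_one, mul_one] at h1
    refine h1.congr' ?_
    filter_upwards [hG, h.eventually_ne one_ne_zero] with x hx hne
    have h2 : Real.log (X x) ≠ 0 := fun h0 => hne (by simp [h0])
    field_simp
  refine ⟨hlim, ?_⟩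
  obtain ⟨x, h1, h2, h3⟩ := (hcX.and (hG.and (h.eventually (lt_mem_nhds one_half_lt_one)))).exists
  by_contra! h0
  have h4 : 0 ≤ Real.log (X x) := by linarith [Real.log_le_log hc h1]
  have h5 : Real.log (X x) / -G x ≤ 0 := div_nonpos_of_nonneg_of_nonpos h4 (by linarith)
  exact absurd (h3.trans_le h5) (by norm_num)

theorem DeBruijnConjugatePair.symm {f g : ℝ → ℝ} (h : DeBruijnConjugatePair f g) :
    DeBruijnConjugatePair g f :=
  ⟨h.slow_right, h.slow_left, h.tendsto_right, h.tendsto_left⟩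

/-- Near infinity, `1 / f` takes the values of `g` along `t f t → ∞`, up to a factor tending
to `1`. -/
theorem DeBruijnConjugatePair.tendsto_inv_of_tendsto {f g : ℝ → ℝ}
    (h : DeBruijnConjugatePair f g) :
    (Tendsto g atTop atTop → Tendsto (fun t => (f t)⁻¹) atTop atTop) ∧
    ∀ p, Tendsto g atTop (𝓝 p) → Tendsto (fun t => (f t)⁻¹) atTop (𝓝 p) := by
  have h0 := h.tendsto_left.inv₀ one_ne_zero
  rw [inv_one] at h0
  have heq : (fun t => g (t * f t) * (f t * g (t * f t))⁻¹) =ᶠ[atTop] fun t => (f t)⁻¹ := by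
    filter_upwards [eventually_gt_atTop 0] with t ht
    have h1 := h.slow_left.pos t ht
    have h2 := h.slow_right.pos _ (mul_pos ht h1)
    field_simp
  refine ⟨fun hg => ?_, fun p hg => ?_⟩
  · exact ((hg.comp h.slow_left.tendsto_mul_self).atTop_mul_pos one_pos h0).congr' heq
  · have h1 := (hg.comp h.slow_left.tendsto_mul_self).mul h0
    rw [mul_one] at h1
    exact h1.congr' heq

namespace IsLaplacePair

variable {ρ : Measure ℝ} {F n f g : ℝ → ℝ} {τ γ : ℝ}

/-- The case `γ = 0`. The speed `1 / f` need not tend to infinity: it does so exactly when the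
origin has no mass. If it has mass `c > 0`, both sides say that `g → -log c > 0`. -/
theorem asympEquiv_iff_zero (h : IsLaplacePair ρ F n τ) (hf : DeBruijnConjugatePair f g) :
    AsympEquiv atTop (fun t => Real.log (F t)) (fun t => -(t ^ (0 : ℝ) * (f t) ^ ((0 : ℝ) - 1))) ↔
      AsympEquiv (𝓝[>] (0 : ℝ)) (fun E => Real.log (n E))
        (fun E => -((1 - 0) * (0 / E) ^ ((0 : ℝ) / (1 - 0)) * g (E ^ (1 / ((0 : ℝ) - 1))))) := by
  have hγ : (0 : ℝ) ∈ Ico (0 : ℝ) 1 := by simp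
  have hTR := h.asympEquiv_distrib hγ hf
  have hRT := h.asympEquiv_transform hγ hf
  simp only [Real.rpow_zero, one_mul, zero_sub, Real.rpow_neg_one, sub_zero, div_one, div_neg]
    at hTR hRT ⊢
  have hfpos : ∀ᶠ t in atTop, 0 < (f t)⁻¹ := by
    filter_upwards [eventually_gt_atTop 0] with t ht
    exact inv_pos.2 (hf.slow_left.pos t ht)
  have hgf : ∀ p, 0 < p → Tendsto (fun t => (f t)⁻¹) atTop (𝓝 p) → Tendsto g atTop (𝓝 p) :=
    fun p hp hlim => by
      have h1 : Tendsto f atTop (𝓝 p⁻¹) := by simpa using hlim.inv₀ hp.ne'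
      simpa using (hf.symm.tendsto_inv_of_tendsto.2 _ h1).inv₀ (inv_ne_zero hp.ne')
  have hgf' : Tendsto (fun t => (f t)⁻¹) atTop atTop → Tendsto g atTop atTop := fun hlim => by
    refine ((hlim.comp hf.slow_right.tendsto_mul_self).atTop_mul_pos one_pos
      hf.tendsto_right).congr' ?_
    filter_upwards [eventually_gt_atTop 0] with t ht
    have h2 := hf.slow_right.pos t ht
    have h1 := hf.slow_left.pos _ (mul_pos ht h2)
    simp only [Function.comp]
    field_simp
  have hcomp : ∀ {l : Filter ℝ}, Tendsto (fun E : ℝ => g E⁻¹) (𝓝[>] 0) l →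
      Tendsto g atTop l := fun hl => by
    refine (hl.comp tendsto_inv_atTop_nhdsGT_zero).congr fun t => ?_
    simp only [Function.comp, inv_inv]
  have hto : Tendsto (fun E : ℝ => E⁻¹) (𝓝[>] 0) atTop :=
    tendsto_inv_nhdsGT_zero
  have hgpos : ∀ᶠ E in 𝓝[>] (0 : ℝ), 0 < g E⁻¹ := by
    filter_upwards [self_mem_nhdsWithin] with E hE
    exact hf.slow_right.pos _ (inv_pos.2 hE)
  obtain ⟨c, hc0, hcF, hcn, hF, hn⟩ := h.exists_limit
  rcases hc0.eq_or_lt with rfl | hc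
  · exact ⟨fun hL => hTR (hgf' (hL.tendsto_atTop_of_log hF)) hL,
      fun hR => hRT (hf.tendsto_inv_of_tendsto.1 (hcomp (hR.tendsto_atTop_of_log hn))) hR⟩
  · refine ⟨fun hL => ?_, fun hR => ?_⟩
    · obtain ⟨h1, h2⟩ := hL.tendsto_of_log hF hc (eventually_ge_atTop τ |>.mono hcF) hfpos
      have h3 := (hn.log hc.ne').div ((hgf _ h2 h1).comp hto).neg (by linarith)
      rw [neg_neg, div_self (by linarith)] at h3
      exact h3
    · obtain ⟨h1, h2⟩ := hR.tendsto_of_log hn hc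
        (by filter_upwards [self_mem_nhdsWithin] with E hE using hcn E hE) hgpos
      have h3 := (hF.log hc.ne').div (hf.tendsto_inv_of_tendsto.2 _ (hcomp h1)).neg
        (by linarith)
      rw [neg_neg, div_self (by linarith)] at h3
      exact h3

end IsLaplacePair

theorem theorem3 (μ : Measure ℝ) (N : ℝ → ℝ) (hN : IsDistributionFunction N μ)
    (η : ℝ) (hη : ∀ E, E ≤ η → N E = 0)
    (hfin : ∃ τ : ℝ, 0 < τ ∧ shiftedLaplace μ η τ < ⊤)
    (f fsharp : ℝ → ℝ) (hf : DeBruijnConjugatePair f fsharp)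
    (γ : ℝ) (hγ : γ ∈ Ico (0 : ℝ) 1) :
    AsympEquiv atTop
        (fun t => Real.log (shiftedLaplace μ η t).toReal)
        (fun t => -(t ^ γ * (f t) ^ (γ - 1))) ↔
      AsympEquiv (𝓝[>] (0 : ℝ))
        (fun E => Real.log (N (η + E)))
        (fun E => -((1 - γ) * (γ / E) ^ (γ / (1 - γ)) * fsharp (E ^ (1 / (γ - 1))))) := by
  obtain ⟨τ, hτ, hτfin⟩ := hfin
  have h := isLaplacePair_shift hN (hη η le_rfl) hτ hτfin
  rcases hγ.1.eq_or_lt with rfl | h0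
  · exact h.asympEquiv_iff_zero hf
  · exact ⟨h.asympEquiv_distrib hγ hf (by simpa using hf.slow_right.tendsto_rpow_mul_rpow h0 1),
      h.asympEquiv_transform hγ hf (hf.slow_left.tendsto_rpow_mul_rpow h0 _)⟩
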